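/- Let $H(s)=C(sE-A)^{-1}B+D$ be the $p\times m$ transfer function of a system with real matrices $E,A\in\mathbb R^{n\times n}$, $B\in\mathbb R^{n\times m}$, $C\in\mathbb R^{p\times n}$, $D\in\mathbb R^{p\times m}$. Assume that the system is stable, i.e. $\det(sE-A)=0$ only for $\operatorname{Re}s<0$, and that $H(s)\to 0$ as $s\to\infty$ (for nonsingular $E$ this means $D=0$). For poles $\lambda_1,\dots,\lambda_r$ with $\operatorname{Re}\lambda_i<0$ (distinct or not) and residue directions $b_i\in\mathbb C^m$, $c_i\in\mathbb C^p$, let $$H_r(s)=\sum_{i=1}^r\frac{c_ib_i^T}{s-\lambda_i},\qquad \mathcal J=\|H-H_r\|_{\mathcal H_2}^2=\frac1{2\pi}\int_{-\infty}^{\infty}\|H(\imath\omega)-H_r(\imath\omega)\|_F^2\,d\omega .$$ Call such parameters $\theta=(\lambda_i,b_i,c_i)_i$ stable, and call them real if $H_r$ is a real rational function, i.e. $H_r(\bar s)=\overline{H_r(s)}$ whenever neither $s$ nor $\bar s$ is one of the $\lambda_i$ (the poles and directions themselves may be complex). Put, for $i,\ell=1,\dots,r$, $$\frac{\partial \mathcal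 J}{\partial\lambda_i}=-2\,c_i^T\bigl(H_r'(-\lambda_i)-H'(-\lambda_i)\bigr)b_i,\qquad \bigl(\nabla_{\{b,c\}}\mathcal J\bigr)_\ell=\begin{pmatrix}2\,\bigl(c_\ell^TH_r(-\lambda_\ell)-c_\ell^TH(-\lambda_\ell)\bigr)^T\\[2pt] 2\,\bigl(H_r(-\lambda_\ell)b_\ell-H(-\lambda_\ell)b_\ell\bigr)\end{pmatrix},\tag{1}$$ where $\nabla_{\{b,c\}}\mathcal J$ is the vector of length $r(m+p)$ belonging to the listing $[b_1^T,c_1^T,\dots,b_r^T,c_r^T]^T$ of the residue directions. Then, for all stable parameters, $H$ and $H_r$ are holomorphic in the open right half-plane and $\mathcal J$ is finite, and the expressions (1) are the partial derivatives of $\mathcal J$ in the following two senses. 1. At all stable real parameters, $\mathcal J$ is differentiable as a function of the real and imaginary parts of all the $\lambda_i,b_i,c_i$, and in every direction $(\delta\lambda_i,\delta b_i,\delta c_i)_i$ (complex, not required to keep $H_r$ real) its derivative is $$\operatorname{Re}\Bigl(\sum_{i=1}^r\frac{\partial \mathcal J}{\partial\lambda_i}\,\delta\lambda_i+\sum_{\ell=1}^r\bigl(\nabla_{\{b,c\}}\mathcal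 J\bigr)_\ell^T\begin{pmatrix}\delta b_\ell\\ \delta c_\ell\end{pmatrix}\Bigr).$$ In particular, for real $\lambda_i,b_i,c_i$ the expressions (1) are the ordinary partial derivatives of $\mathcal J$. 2. There is exactly one holomorphic function of $(\lambda_i,b_i,c_i)_i$ on the set of stable parameters that equals $\mathcal J$ at all stable real parameters, and at every stable parameter its complex partial derivatives with respect to the $\lambda_i$ and to the entries of the $b_\ell$ and $c_\ell$ are given by (1). -/

import Mathlib

open scoped Matrix

noncomputable section

/-- A linear time-invariant system `E x' = A x + B u`, `y = C x + D u` with real coefficient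
matrices, state dimension `n`, `m` inputs and `p` outputs. -/
structure LTISystem (n m p : ℕ) where
  E : Matrix (Fin n) (Fin n) ℝ
  A : Matrix (Fin n) (Fin n) ℝ
  B : Matrix (Fin n) (Fin m) ℝ
  C : Matrix (Fin p) (Fin n) ℝ
  D : Matrix (Fin p) (Fin m) ℝ

namespace LTISystem

variable {n m p : ℕ}

/-- The matrix `s E - A`. -/
def pencil (S : LTISystem n m p) (s : ℂ) : Matrix (Fin n) (Fin n) ℂ :=
  s • S.E.map Complex.ofReal - S.A.map Complex.ofReal

/-- The transfer function `H(s) = C (s E - A)⁻¹ B + D`. -/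
def transfer (S : LTISystem n m p) (s : ℂ) : Matrix (Fin p) (Fin m) ℂ :=
  S.C.map Complex.ofReal * (S.pencil s)⁻¹ * S.B.map Complex.ofReal + S.D.map Complex.ofReal

/-- All eigenvalues of the pencil lie in the open left half-plane (in particular the pencil is
regular). -/
def IsStable (S : LTISystem n m p) : Prop :=
  ∀ s : ℂ, (S.pencil s).det = 0 → s.re < 0

/-- `H(s) → 0` as `s → ∞`. For nonsingular `E` this says that `D = 0`. -/
def VanishesAtInfinity (S : LTISystem n m p) : Prop :=
  Filter.Tendsto S.transfer (Bornology.cobounded ℂ) (nhds 0)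

end LTISystem

/-- The Frobenius norm of a complex matrix. -/
def frobNorm {p m : ℕ} (M : Matrix (Fin p) (Fin m) ℂ) : ℝ :=
  Real.sqrt (∑ a, ∑ j, ‖M a j‖ ^ 2)

/-- `‖G(iω)‖_F²` is integrable over the real line. -/
def HasFiniteH2Norm {p m : ℕ} (G : ℂ → Matrix (Fin p) (Fin m) ℂ) : Prop :=
  MeasureTheory.Integrable (fun ω : ℝ => frobNorm (G (Complex.I * ω)) ^ 2)

/-- The `H₂` norm `((1 / 2π) ∫ ‖G(iω)‖_F² dω)^(1/2)`. -/
def h2Norm {p m : ℕ} (G : ℂ → Matrix (Fin p) (Fin m) ℂ) : ℝ :=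
  Real.sqrt (1 / (2 * Real.pi) * ∫ ω : ℝ, frobNorm (G (Complex.I * ω)) ^ 2)

/-- The entrywise complex derivative of a matrix-valued function. -/
def matDeriv {p m : ℕ} (G : ℂ → Matrix (Fin p) (Fin m) ℂ) (s : ℂ) : Matrix (Fin p) (Fin m) ℂ :=
  Matrix.of fun a j => deriv (fun z => G z a j) s

/-- The variables of a pole-residue form of order `r`: the poles `λ_1, …, λ_r`, and the residue
directions listed as `[b_1ᵀ, c_1ᵀ, …, b_rᵀ, c_rᵀ]ᵀ`, that is, `r` blocks of length `m + p`. -/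
abbrev PRParams (r m p : ℕ) : Type :=
  (Fin r → ℂ) × (Fin r → Fin m ⊕ Fin p → ℂ)

namespace PRParams

variable {r m p : ℕ}

/-- The pole `λ_i`. -/
def pole (θ : PRParams r m p) (i : Fin r) : ℂ := θ.1 i

/-- The right residue direction `b_i`. -/
def rdir (θ : PRParams r m p) (i : Fin r) : Fin m → ℂ := fun j => θ.2 i (Sum.inl j)

/-- The left residue direction `c_i`. -/
def ldir (θ : PRParams r m p) (i : Fin r) : Fin p → ℂ := fun a => θ.2 i (Sum.inr a)

/-- `H_r(s) = ∑ i, c_i b_iᵀ / (s - λ_i)`. -/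
def reduced (θ : PRParams r m p) (s : ℂ) : Matrix (Fin p) (Fin m) ℂ :=
  ∑ i, (s - θ.pole i)⁻¹ • Matrix.vecMulVec (θ.ldir i) (θ.rdir i)

/-- All the poles lie in the open left half-plane. -/
def IsStable (θ : PRParams r m p) : Prop := ∀ i, (θ.pole i).re < 0

/-- `H_r` is a real rational function: `H_r(s̄)` is the conjugate of `H_r(s)` off the poles.
The parameters themselves may be complex. -/
def IsReal (θ : PRParams r m p) : Prop :=
  ∀ s : ℂ, (∀ i, s ≠ θ.pole i) → (∀ i, star s ≠ θ.pole i) →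
    θ.reduced (star s) = (θ.reduced s).map star

end PRParams

section Error

variable {n m p r : ℕ}

/-- The squared `H₂` error `J = ‖H - H_r‖²`, as a function of poles and residue directions. -/
def h2Error (S : LTISystem n m p) (θ : PRParams r m p) : ℝ :=
  h2Norm (fun s => S.transfer s - θ.reduced s) ^ 2

/-- `- 2 c_iᵀ (H_r'(-λ_i) - H'(-λ_i)) b_i`. -/
def poleGrad (S : LTISystem n m p) (θ : PRParams r m p) (i : Fin r) : ℂ :=
  -2 * (θ.ldir i ⬝ᵥ
    ((matDeriv θ.reduced (-θ.pole i) - matDeriv S.transfer (-θ.pole i)) *ᵥ θ.rdir i))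

/-- The block of length `m + p` with upper part `2 (c_ℓᵀ H_r(-λ_ℓ) - c_ℓᵀ H(-λ_ℓ))ᵀ` and
lower part `2 (H_r(-λ_ℓ) b_ℓ - H(-λ_ℓ) b_ℓ)`. -/
def dirGrad (S : LTISystem n m p) (θ : PRParams r m p) (l : Fin r) : Fin m ⊕ Fin p → ℂ :=
  Sum.elim
    ((2 : ℂ) • (θ.ldir l ᵥ* θ.reduced (-θ.pole l) - θ.ldir l ᵥ* S.transfer (-θ.pole l)))
    ((2 : ℂ) • (θ.reduced (-θ.pole l) *ᵥ θ.rdir l - S.transfer (-θ.pole l) *ᵥ θ.rdir l))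

/-- `F` is holomorphic in the poles and residue directions on the set of stable parameters, and
equals the squared `H₂` error wherever `H_r` is a real rational function. -/
def IsHolomorphicError (S : LTISystem n m p) (F : PRParams r m p → ℂ) : Prop :=
  DifferentiableOn ℂ F {θ | θ.IsStable} ∧
    ∀ θ : PRParams r m p, θ.IsStable → θ.IsReal → F θ = (h2Error S θ : ℂ)

end Error

end

open scoped Matrix

noncomputable section

open Complex MeasureTheory Filter Topology

/-! The imaginary axis reproduces values: if `G` is holomorphic on the closed right half-plane and
`O(1/s)`, its inner product with `1/(s - λ)` is, up to `2π`, the conjugate of `G(-conj λ)`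
(`integral_conj_mul_inv_sub`). Expanding the square and evaluating the terms that contain `H_r` in
this way shows that `J` is the real part of `polarizedError` at `(θ, star θ)` (`h2Error_eq`). This
expression is holomorphic in two independent sets of stable parameters.

If `H_r` is real, `θ` and `star θ` define the same function on the closed right half-plane, so the
second argument may be replaced by `θ`. The diagonal values of `polarizedError` are therefore the
holomorphic extension of `J`. It is unique because the parameters fixed by conjugation already
determine a holomorphic function (`eq_of_eqOn_star_eq`).

The pairing of two pole-residue forms is symmetric (`pairing_reduced_comm`), so one derivative
formula serves both arguments. On the diagonal they contribute equally; at `(θ, star θ)` with `H_r`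
real they contribute complex conjugates, with equal real parts. This is the factor 2 in the
gradients. -/

/-- Holomorphic on the closed right half-plane, with decay of order `k` there. -/
structure HalfPlaneDecay (k : ℕ) (f : ℂ → ℂ) : Prop where
  differentiableAt : ∀ s : ℂ, 0 ≤ s.re → DifferentiableAt ℂ f s
  bound : ∃ C : ℝ, ∀ s : ℂ, 0 ≤ s.re → (1 + ‖s‖ ^ k) * ‖f s‖ ≤ C

/-! ### Decay classes on the closed right half-plane. -/

namespace HalfPlaneDecay

variable {k : ℕ} {f g : ℂ → ℂ}

theorem of_bound_large (hd : ∀ s : ℂ, 0 ≤ s.re → DifferentiableAt ℂ f s) {C R : ℝ}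
    (hC : ∀ s : ℂ, 0 ≤ s.re → R ≤ ‖s‖ → ‖s‖ ^ k * ‖f s‖ ≤ C) : HalfPlaneDecay k f := by
  refine ⟨hd, ?_⟩
  have hcpt : IsCompact (Metric.closedBall (0 : ℂ) (max R 1) ∩ {s : ℂ | 0 ≤ s.re}) :=
    (isCompact_closedBall _ _).inter_right (isClosed_le continuous_const continuous_re)
  have hcont : ContinuousOn (fun s => (1 + ‖s‖ ^ k) * ‖f s‖)
      (Metric.closedBall (0 : ℂ) (max R 1) ∩ {s : ℂ | 0 ≤ s.re}) := by
    have : ContinuousOn f (Metric.closedBall (0 : ℂ) (max R 1) ∩ {s : ℂ | 0 ≤ s.re}) :=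
      fun s hs => (hd s hs.2).continuousAt.continuousWithinAt
    fun_prop
  obtain ⟨M, hM⟩ := hcpt.bddAbove_image hcont
  -- Outside a disc of radius at least 1, `1 + ‖s‖ ^ k ≤ 2 * ‖s‖ ^ k`, hence `2 * C`; inside it
  -- compactness gives `M`.
  refine ⟨max M (2 * C), fun s hs => ?_⟩
  rcases le_total ‖s‖ (max R 1) with h | h
  · exact le_max_of_le_left (hM ⟨s, ⟨by simpa using h, hs⟩, rfl⟩)
  · refine le_max_of_le_right ?_
    have h1 := hC s hs ((le_max_left _ _).trans h)
    have h2 : 1 ≤ ‖s‖ ^ k := one_le_pow₀ ((le_max_right _ _).trans h)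
    nlinarith [norm_nonneg (f s)]

theorem bound_nonneg (hf : HalfPlaneDecay k f) :
    ∃ C : ℝ, 0 ≤ C ∧ ∀ s : ℂ, 0 ≤ s.re → (1 + ‖s‖ ^ k) * ‖f s‖ ≤ C := by
  obtain ⟨C, hC⟩ := hf.bound
  exact ⟨C, (by positivity : (0 : ℝ) ≤ (1 + ‖(0 : ℂ)‖ ^ k) * ‖f 0‖).trans (hC 0 (by simp)), hC⟩

theorem add (hf : HalfPlaneDecay k f) (hg : HalfPlaneDecay k g) :
    HalfPlaneDecay k (fun s => f s + g s) := by
  obtain ⟨C, hC⟩ := hf.bound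
  obtain ⟨C', hC'⟩ := hg.bound
  refine ⟨fun s hs => (hf.differentiableAt s hs).add (hg.differentiableAt s hs), C + C',
    fun s hs => ?_⟩
  calc (1 + ‖s‖ ^ k) * ‖f s + g s‖ ≤ (1 + ‖s‖ ^ k) * (‖f s‖ + ‖g s‖) := by
        gcongr; exact norm_add_le _ _
    _ ≤ C + C' := by linarith [hC s hs, hC' s hs]

theorem const_mul (c : ℂ) (hf : HalfPlaneDecay k f) : HalfPlaneDecay k (fun s => c * f s) := by
  obtain ⟨C, hC⟩ := hf.bound
  refine ⟨fun s hs => (hf.differentiableAt s hs).const_mul c, ‖c‖ * C, fun s hs => ?_⟩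
  rw [norm_mul, mul_left_comm]
  exact mul_le_mul_of_nonneg_left (hC s hs) (norm_nonneg c)

theorem zero : HalfPlaneDecay k (fun _ => 0) :=
  ⟨fun _ _ => differentiableAt_const _, 0, by simp⟩

theorem sub (hf : HalfPlaneDecay k f) (hg : HalfPlaneDecay k g) :
    HalfPlaneDecay k (fun s => f s - g s) := by
  simpa [sub_eq_add_neg] using hf.add (hg.const_mul (-1))

theorem sum {ι : Type*} (t : Finset ι) {F : ι → ℂ → ℂ} (h : ∀ i ∈ t, HalfPlaneDecay k (F i)) :
    HalfPlaneDecay k (fun s => ∑ i ∈ t, F i s) := by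
  classical
  induction t using Finset.induction_on with
  | empty => simpa using zero
  | insert i t hi ih =>
    simp only [Finset.sum_insert hi]
    exact (h i (by simp)).add (ih fun j hj => h j (by simp [hj]))

theorem mul_one_one (hf : HalfPlaneDecay 1 f) (hg : HalfPlaneDecay 1 g) :
    HalfPlaneDecay 2 (fun s => f s * g s) := by
  obtain ⟨C, h0, hC⟩ := hf.bound_nonneg
  obtain ⟨C', h0', hC'⟩ := hg.bound_nonneg
  refine ⟨fun s hs => (hf.differentiableAt s hs).mul (hg.differentiableAt s hs), C * C',
    fun s hs => ?_⟩
  have h1 := hC s hs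
  have h2 := hC' s hs
  rw [pow_one] at h1 h2
  calc (1 + ‖s‖ ^ 2) * ‖f s * g s‖ ≤ (1 + ‖s‖) * (1 + ‖s‖) * (‖f s‖ * ‖g s‖) := by
        rw [norm_mul]; gcongr; nlinarith [norm_nonneg s]
    _ = ((1 + ‖s‖) * ‖f s‖) * ((1 + ‖s‖) * ‖g s‖) := by ring
    _ ≤ C * C' := by gcongr

theorem inv_sub {μ : ℂ} (hμ : μ.re < 0) : HalfPlaneDecay 1 (fun s => (s - μ)⁻¹) := by
  -- For `‖s‖ ≥ 2 * ‖μ‖` one has `‖s - μ‖ ≥ ‖s‖ / 2`.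
  refine of_bound_large (C := 2) (R := 2 * ‖μ‖) (fun s hs => ?_) fun s hs hR => ?_
  · have : s - μ ≠ 0 := fun h => by
      have := congrArg re h
      simp at this; linarith
    fun_prop (disch := assumption)
  · have h : s - μ ≠ 0 := fun h => by
      have := congrArg re h
      simp at this; linarith
    rw [pow_one, norm_inv, ← div_eq_mul_inv, div_le_iff₀ (norm_pos_iff.2 h)]
    linarith [norm_sub_norm_le s μ]

theorem continuous_axis (hf : HalfPlaneDecay k f) : Continuous fun ω : ℝ => f (I * ω) := by
  rw [continuous_iff_continuousAt]
  intro ω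
  have : ContinuousAt f (I * ω) := (hf.differentiableAt _ (by simp)).continuousAt
  exact ContinuousAt.comp' this (by fun_prop)

theorem integrable_axis (hf : HalfPlaneDecay 2 f) : Integrable fun ω : ℝ => f (I * ω) := by
  obtain ⟨C, hC⟩ := hf.bound
  refine (integrable_inv_one_add_sq.const_mul C).mono' hf.continuous_axis.aestronglyMeasurable
    (ae_of_all _ fun ω => ?_)
  have := hC (I * ω) (by simp)
  rw [← div_eq_mul_inv, le_div_iff₀ (by positivity)]
  simpa [mul_comm] using this

/-- Cauchy's theorem on the rectangle `[0, R] × [-R, R]`: the three sides off the axis have total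
length `4R`, and `f` is at most `C / R ^ 2` there. -/
theorem integral_axis_eq_zero (hf : HalfPlaneDecay 2 f) : ∫ ω : ℝ, f (I * ω) = 0 := by
  obtain ⟨C, hC0, hC⟩ := hf.bound_nonneg
  have hlim : Tendsto (fun R : ℝ => ∫ ω in (-R)..R, f (I * ω)) atTop (𝓝 (∫ ω : ℝ, f (I * ω))) :=
    intervalIntegral_tendsto_integral hf.integrable_axis tendsto_neg_atTop_atBot tendsto_id
  refine tendsto_nhds_unique hlim ?_
  have hbd : ∀ R : ℝ, 0 < R → ∀ s : ℂ, 0 ≤ s.re → R ≤ ‖s‖ → ‖f s‖ ≤ C / R ^ 2 := by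
    intro R hR s hs hRs
    rw [le_div_iff₀ (by positivity)]
    have : R ^ 2 ≤ 1 + ‖s‖ ^ 2 := by nlinarith
    nlinarith [hC s hs, norm_nonneg (f s)]
  have key : ∀ R : ℝ, 0 < R → ‖∫ ω in (-R)..R, f (I * ω)‖ ≤ 4 * C / R := by
    intro R hR
    have hrect := integral_boundary_rect_eq_zero_of_continuousOn_of_differentiableOn f
      (⟨0, -R⟩ : ℂ) (⟨R, R⟩ : ℂ)
      (fun s hs => by
        simp only [mem_reProdIm, Set.uIcc_of_le hR.le] at hs
        exact (hf.differentiableAt s hs.1.1).continuousAt.continuousWithinAt)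
      (fun s hs => by
        simp only [mem_reProdIm, min_eq_left hR.le] at hs
        exact (hf.differentiableAt s hs.1.1.le).differentiableWithinAt)
    simp only at hrect
    have b1 : ‖∫ x in (0 : ℝ)..R, f (x + (-R : ℝ) * I)‖ ≤ C / R ^ 2 * |R - 0| := by
      refine intervalIntegral.norm_integral_le_of_norm_le_const fun x hx => ?_
      rw [Set.uIoc_of_le hR.le] at hx
      refine hbd R hR _ (by simpa using hx.1.le) ?_
      refine le_trans ?_ (abs_im_le_norm _)
      simp [abs_of_pos hR]
    have b2 : ‖∫ x in (0 : ℝ)..R, f (x + (R : ℝ) * I)‖ ≤ C / R ^ 2 * |R - 0| := by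
      refine intervalIntegral.norm_integral_le_of_norm_le_const fun x hx => ?_
      rw [Set.uIoc_of_le hR.le] at hx
      refine hbd R hR _ (by simpa using hx.1.le) ?_
      refine le_trans ?_ (abs_im_le_norm _)
      simp [abs_of_pos hR]
    have b3 : ‖∫ y in (-R)..R, f ((R : ℝ) + y * I)‖ ≤ C / R ^ 2 * |R - -R| := by
      refine intervalIntegral.norm_integral_le_of_norm_le_const fun x hx => ?_
      refine hbd R hR _ (by simpa using hR.le) ?_
      refine le_trans ?_ (abs_re_le_norm _)
      simp [abs_of_pos hR]
    have e : ∫ ω in (-R)..R, f (I * ω) = ∫ y in (-R)..R, f ((0 : ℝ) + y * I) := by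
      simp [mul_comm]
    have e2 : I • ∫ y in (-R)..R, f ((0 : ℝ) + y * I) =
        (∫ x in (0 : ℝ)..R, f (x + (-R : ℝ) * I)) - (∫ x in (0 : ℝ)..R, f (x + (R : ℝ) * I)) +
        I • ∫ y in (-R)..R, f ((R : ℝ) + y * I) := by
      linear_combination -hrect
    have e3 : ‖∫ ω in (-R)..R, f (I * ω)‖ = ‖I • ∫ y in (-R)..R, f ((0 : ℝ) + y * I)‖ := by
      rw [e, norm_smul, norm_I, one_mul]
    rw [e3, e2]
    refine (norm_add_le _ _).trans ?_
    rw [norm_smul, norm_I, one_mul]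
    have a1 : |R - 0| = R := by simp [abs_of_pos hR]
    have a2 : |R - -R| = 2 * R := by rw [sub_neg_eq_add, abs_of_pos (by linarith)]; ring
    rw [a1] at b1 b2
    rw [a2] at b3
    have a3 : C / R ^ 2 * R + C / R ^ 2 * R + C / R ^ 2 * (2 * R) = 4 * C / R := by
      field_simp; ring
    linarith [norm_sub_le (∫ x in (0 : ℝ)..R, f (x + (-R : ℝ) * I))
      (∫ x in (0 : ℝ)..R, f (x + (R : ℝ) * I))]
  refine squeeze_zero_norm' (eventually_gt_atTop 0 |>.mono key) ?_
  exact tendsto_const_nhds.div_atTop tendsto_id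

end HalfPlaneDecay

/-! ### The Poisson kernel and Cauchy's formula on the axis. -/

theorem poisson_kernel_eq (μ : ℂ) (ω : ℝ) :
    (I * ω + (starRingEnd ℂ) μ)⁻¹ * (μ - I * ω)⁻¹ =
      (((ω - μ.im) ^ 2 + μ.re ^ 2)⁻¹ : ℝ) := by
  rw [← mul_inv, ofReal_inv]
  congr 1
  apply Complex.ext
  · rw [ofReal_re]; simp; ring
  · rw [ofReal_im]; simp; ring

theorem integral_poisson_kernel {μ : ℂ} (hμ : 0 < μ.re) :
    ∫ ω : ℝ, ((ω - μ.im) ^ 2 + μ.re ^ 2)⁻¹ = Real.pi / μ.re := by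
  rw [integral_sub_right_eq_self (fun ω : ℝ => (ω ^ 2 + μ.re ^ 2)⁻¹) μ.im]
  have h : (fun ω : ℝ => (ω ^ 2 + μ.re ^ 2)⁻¹) =
      fun ω => (μ.re ^ 2)⁻¹ * (1 + (μ.re⁻¹ * ω) ^ 2)⁻¹ := by
    funext ω
    rw [← mul_inv]; congr 1; field_simp; ring
  rw [h, integral_const_mul, Measure.integral_comp_mul_left (fun x : ℝ => (1 + x ^ 2)⁻¹),
    integral_univ_inv_one_add_sq, inv_inv, abs_of_pos hμ, smul_eq_mul]
  field_simp

namespace HalfPlaneDecay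

variable {f : ℂ → ℂ}

/-- Decay of the difference quotient at a point of the open right half-plane. -/
theorem dslope_of_eq_zero (hf : HalfPlaneDecay 1 f) {μ : ℂ} (hμ : 0 < μ.re) (h0 : f μ = 0) :
    HalfPlaneDecay 2 (dslope f μ) := by
  obtain ⟨C, hC0, hC⟩ := hf.bound_nonneg
  refine of_bound_large (C := 2 * C) (R := 2 * ‖μ‖ + 1) (fun s hs => ?_) fun s hs hR => ?_
  · rcases eq_or_ne s μ with rfl | hne
    · have hnhds : {z : ℂ | 0 < z.re} ∈ 𝓝 s :=
        (isOpen_lt continuous_const continuous_re).mem_nhds hμ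
      have := (Complex.differentiableOn_dslope hnhds).2
        (fun z hz => (hf.differentiableAt z (le_of_lt hz)).differentiableWithinAt)
      exact this.differentiableAt hnhds
    · exact (differentiableAt_dslope_of_ne hne).2 (hf.differentiableAt s hs)
  · have hne : s ≠ μ := by
      rintro rfl
      linarith [norm_nonneg s]
    have hpos : 0 < ‖s - μ‖ := norm_pos_iff.2 (sub_ne_zero.2 hne)
    have h1 : ‖s - μ‖ * ‖dslope f μ s‖ = ‖f s‖ := by
      rw [← norm_mul, ← smul_eq_mul, sub_smul_dslope_of_zero h0]
    have h2 : ‖s‖ ≤ 2 * ‖s - μ‖ := by linarith [norm_sub_norm_le s μ]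
    have h3 := hC s hs
    rw [pow_one] at h3
    calc ‖s‖ ^ 2 * ‖dslope f μ s‖ = ‖s‖ * (‖s‖ * ‖dslope f μ s‖) := by ring
      _ ≤ ‖s‖ * (2 * ‖s - μ‖ * ‖dslope f μ s‖) := by gcongr
      _ = 2 * (‖s‖ * ‖f s‖) := by rw [← h1]; ring
      _ ≤ 2 * C := by nlinarith [norm_nonneg (f s)]

/-- Cauchy's integral formula for the right half-plane. -/
theorem integral_axis_cauchy (hf : HalfPlaneDecay 1 f) {μ : ℂ} (hμ : 0 < μ.re) :
    ∫ ω : ℝ, f (I * ω) * (μ - I * ω)⁻¹ = 2 * Real.pi * f μ := by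
  -- With this `κ`, subtracting `κ / (s + conj μ)` makes the function vanish at `μ`, and the new
  -- pole lies in the left half-plane. The difference divided by `s - μ` then has decay of order 2
  -- and integrates to zero, so only `κ` times the Poisson kernel remains.
  set κ : ℂ := f μ * (2 * μ.re : ℝ) with hκ
  have hμ' : (-(starRingEnd ℂ) μ).re < 0 := by simpa using hμ
  have hF := hf.sub ((inv_sub hμ').const_mul κ)
  set F : ℂ → ℂ := fun s => f s - κ * (s - -(starRingEnd ℂ) μ)⁻¹ with hFdef
  have hF0 : F μ = 0 := by
    have h2 : μ - -(starRingEnd ℂ) μ = (2 * μ.re : ℝ) := by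
      rw [sub_neg_eq_add, add_conj]
    have h3 : ((2 * μ.re : ℝ) : ℂ) ≠ 0 := by
      exact_mod_cast (by positivity : (2 * μ.re) ≠ 0)
    simp only [hFdef, hκ, h2, mul_assoc, mul_inv_cancel₀ h3, mul_one, sub_self]
  have hd := hF.dslope_of_eq_zero hμ hF0
  have hpt : ∀ ω : ℝ, f (I * ω) * (μ - I * ω)⁻¹ =
      -dslope F μ (I * ω) + κ * ((((ω - μ.im) ^ 2 + μ.re ^ 2)⁻¹ : ℝ) : ℂ) := by
    intro ω
    have hne : μ - I * ω ≠ 0 := fun h => by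
      have := congrArg re h
      simp at this; linarith
    have h1 : (I * ω - μ) * dslope F μ (I * ω) = F (I * ω) := by
      rw [← smul_eq_mul, sub_smul_dslope_of_zero hF0]
    have h2 : -dslope F μ (I * ω) = F (I * ω) * (μ - I * ω)⁻¹ := by
      rw [← h1, eq_mul_inv_iff_mul_eq₀ hne]; ring
    rw [h2, ← poisson_kernel_eq μ, hFdef]
    simp only [sub_neg_eq_add]
    ring
  have hint : Integrable fun ω : ℝ => ((ω - μ.im) ^ 2 + μ.re ^ 2)⁻¹ := by
    -- A non-integrable function has integral 0 by convention, but the value computed above is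
    -- positive.
    by_contra h
    have := integral_poisson_kernel hμ
    rw [integral_undef h] at this
    have : 0 < Real.pi / μ.re := by positivity
    linarith
  have hint' : Integrable fun ω : ℝ => κ * ((((ω - μ.im) ^ 2 + μ.re ^ 2)⁻¹ : ℝ) : ℂ) :=
    (hint.ofReal (𝕜 := ℂ)).const_mul κ
  simp_rw [hpt]
  rw [integral_add hd.integrable_axis.fun_neg hint', integral_neg,
    hd.integral_axis_eq_zero, integral_const_mul, integral_complex_ofReal,
    integral_poisson_kernel hμ, hκ]
  have h3 : (μ.re : ℂ) ≠ 0 := by exact_mod_cast hμ.ne'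
  push_cast
  field_simp
  ring

end HalfPlaneDecay

/-! ### Decay and symmetry of the transfer function. -/

/-- A function holomorphic near infinity that tends to zero there is `O(1/s)`. -/
theorem exists_norm_mul_le_of_tendsto_cobounded {f : ℂ → ℂ}
    (hd : ∀ᶠ s in Bornology.cobounded ℂ, DifferentiableAt ℂ f s)
    (h0 : Tendsto f (Bornology.cobounded ℂ) (𝓝 0)) :
    ∃ C R : ℝ, ∀ s : ℂ, R ≤ ‖s‖ → ‖s‖ * ‖f s‖ ≤ C := by
  -- In the coordinate `w = 1/s` infinity is a removable singularity with value 0, and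
  -- differentiability there gives `k w = O(w)`.
  set k : ℂ → ℂ := Function.update (fun w => f w⁻¹) 0 0 with hk
  have hk0 : k 0 = 0 := by simp [hk]
  have hkne : ∀ w, w ≠ 0 → k w = f w⁻¹ := fun w hw => by simp [hk, hw]
  have hinv : Tendsto (fun w : ℂ => w⁻¹) (𝓝[≠] 0) (Bornology.cobounded ℂ) :=
    tendsto_inv₀_nhdsNE_zero
  have hev : ∀ᶠ w in 𝓝[≠] (0 : ℂ), DifferentiableAt ℂ k w := by
    filter_upwards [hinv.eventually hd, self_mem_nhdsWithin] with w hw hw0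
    have hw0' : w ≠ 0 := hw0
    have h1 : DifferentiableAt ℂ (fun w => f w⁻¹) w :=
      DifferentiableAt.comp (g := f) w hw (differentiableAt_inv hw0')
    refine h1.congr_of_eventuallyEq ?_
    filter_upwards [isOpen_ne.mem_nhds hw0'] with z hz using hkne z hz
  have hcont : ContinuousAt k 0 := by
    rw [hk, continuousAt_update_same]
    exact h0.comp hinv
  have hdk : DifferentiableAt ℂ k 0 :=
    (analyticAt_of_differentiable_on_punctured_nhds_of_continuousAt hev hcont).differentiableAt
  obtain ⟨C, hC⟩ := hdk.isBigO_sub.bound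
  rw [hk0] at hC
  have hC' := tendsto_inv₀_cobounded.eventually hC
  rw [← comap_norm_atTop, eventually_comap] at hC'
  obtain ⟨R, hR⟩ := eventually_atTop.1 hC'
  refine ⟨C, max R 1, fun s hs => ?_⟩
  have hs1 : 1 ≤ ‖s‖ := (le_max_right _ _).trans hs
  have hs0 : s ≠ 0 := norm_pos_iff.1 (by linarith)
  have h1 := hR ‖s‖ ((le_max_left _ _).trans hs) s rfl
  rw [hkne _ (inv_ne_zero hs0), inv_inv, sub_zero, sub_zero, norm_inv] at h1
  calc ‖s‖ * ‖f s‖ ≤ ‖s‖ * (C * ‖s‖⁻¹) := by gcongr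
    _ = C := by field_simp

namespace LTISystem

variable {n m p : ℕ} (S : LTISystem n m p)

/-- The pencil `X E - A` as a matrix of polynomials. -/
def polyPencil : Matrix (Fin n) (Fin n) (Polynomial ℂ) :=
  Matrix.of fun i j => Polynomial.X * Polynomial.C (S.E i j : ℂ) - Polynomial.C (S.A i j : ℂ)

theorem mapMatrix_polyPencil (s : ℂ) :
    (Polynomial.evalRingHom s).mapMatrix S.polyPencil = S.pencil s := by
  ext i j
  simp [polyPencil, pencil]
  exact mul_comm _ _

theorem det_pencil (s : ℂ) : (S.pencil s).det = S.polyPencil.det.eval s := by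
  rw [← mapMatrix_polyPencil, ← RingHom.map_det, Polynomial.coe_evalRingHom]

theorem adjugate_pencil (s : ℂ) (i j : Fin n) :
    (S.pencil s).adjugate i j = (S.polyPencil.adjugate i j).eval s := by
  rw [← mapMatrix_polyPencil, ← RingHom.map_adjugate]
  simp

theorem transfer_apply (s : ℂ) (a : Fin p) (j : Fin m) :
    S.transfer s a j = ∑ k, (∑ l, (S.C a l : ℂ) *
      ((S.polyPencil.det.eval s)⁻¹ * (S.polyPencil.adjugate l k).eval s)) * (S.B k j : ℂ)
      + (S.D a j : ℂ) := by
  simp [transfer, Matrix.inv_def, Matrix.mul_apply, det_pencil, adjugate_pencil, Finset.mul_sum,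
    Finset.sum_mul, mul_left_comm, mul_assoc]

theorem differentiableAt_transfer {s : ℂ} (hs : (S.pencil s).det ≠ 0) (a : Fin p) (j : Fin m) :
    DifferentiableAt ℂ (fun z => S.transfer z a j) s := by
  simp only [transfer_apply]
  rw [det_pencil] at hs
  have hdet : DifferentiableAt ℂ (fun z => (S.polyPencil.det.eval z)⁻¹) s :=
    S.polyPencil.det.differentiableAt.inv hs
  have hadj : ∀ l k, DifferentiableAt ℂ (fun z => (S.polyPencil.adjugate l k).eval z) s :=
    fun l k => (S.polyPencil.adjugate l k).differentiableAt
  fun_prop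

/-- Cramer's rule makes the entries rational. Stability at `s = 0` shows that the determinant is not
the zero polynomial, so it has finitely many roots and `H` is holomorphic near infinity. No
invertibility of `E` is needed. -/
theorem halfPlaneDecay_transfer (hS : S.IsStable) (hS0 : S.VanishesAtInfinity)
    (a : Fin p) (j : Fin m) : HalfPlaneDecay 1 (fun z => S.transfer z a j) := by
  have hdet : S.polyPencil.det ≠ 0 := by
    intro h
    have := hS 0 (by rw [det_pencil, h, Polynomial.eval_zero])
    simp at this
  have hev : ∀ᶠ s in Bornology.cobounded ℂ, DifferentiableAt ℂ (fun z => S.transfer z a j) s := by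
    have hfin : Bornology.IsBounded {s : ℂ | S.polyPencil.det.IsRoot s} :=
      (Polynomial.finite_setOfPred_isRoot hdet).isBounded
    filter_upwards [Bornology.isBounded_def.1 hfin] with s hs
    exact S.differentiableAt_transfer (by rw [det_pencil]; exact hs) a j
  have ht : Tendsto (fun z => S.transfer z a j) (Bornology.cobounded ℂ) (𝓝 0) :=
    tendsto_pi_nhds.1 (tendsto_pi_nhds.1 hS0 a) j
  obtain ⟨C, R, hC⟩ := exists_norm_mul_le_of_tendsto_cobounded hev ht
  exact HalfPlaneDecay.of_bound_large
    (fun s hs => S.differentiableAt_transfer (fun h => absurd (hS s h) (not_lt.2 hs)) a j)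
    (fun s _ hR => by rw [pow_one]; exact hC s hR)

theorem conj_transfer (s : ℂ) (a : Fin p) (j : Fin m) :
    (starRingEnd ℂ) (S.transfer ((starRingEnd ℂ) s) a j) = S.transfer s a j := by
  have hp : (S.pencil ((starRingEnd ℂ) s)) = (starRingEnd ℂ).mapMatrix (S.pencil s) := by
    ext i j; simp [pencil]
  simp only [transfer, Matrix.inv_def, hp, ← RingHom.map_adjugate, ← RingHom.map_det]
  simp [Matrix.mul_apply]

end LTISystem

/-! ### Inner products on the imaginary axis. -/

namespace HalfPlaneDecay

variable {f g : ℂ → ℂ}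

theorem integrable_conj_mul (hf : HalfPlaneDecay 1 f) (hg : HalfPlaneDecay 1 g) :
    Integrable fun ω : ℝ => (starRingEnd ℂ) (f (I * ω)) * g (I * ω) := by
  refine (hf.mul_one_one hg).integrable_axis.mono ?_ (ae_of_all _ fun ω => by simp)
  exact ((continuous_conj.comp hf.continuous_axis).mul hg.continuous_axis).aestronglyMeasurable

/-- The complex conjugate of Cauchy's formula at the mirror point `-conj l`. -/
theorem integral_conj_mul_inv_sub (hf : HalfPlaneDecay 1 f) {l : ℂ} (hl : l.re < 0) :
    ∫ ω : ℝ, (starRingEnd ℂ) (f (I * ω)) * (I * ω - l)⁻¹ =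
      2 * Real.pi * (starRingEnd ℂ) (f (-(starRingEnd ℂ) l)) := by
  have h := congrArg (starRingEnd ℂ)
    (hf.integral_axis_cauchy (μ := -(starRingEnd ℂ) l) (by simpa using hl))
  rw [← integral_conj] at h
  simp only [map_mul, map_inv₀, map_sub, map_neg, conj_conj, conj_I, conj_ofReal,
    Complex.conj_ofNat] at h
  rw [← h]
  congr 1; funext ω; congr 2; ring

end HalfPlaneDecay

/-- The reflection `G♯(s) = conj (G (conj s))`. -/
def conjReflect {p m : ℕ} (G : ℂ → Matrix (Fin p) (Fin m) ℂ) (s : ℂ) : Matrix (Fin p) (Fin m) ℂ :=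
  (G ((starRingEnd ℂ) s)).map (starRingEnd ℂ)

/-- The Frobenius inner product of two transfer functions at the point `iω`. -/
def axisInner {p m : ℕ} (G K : ℂ → Matrix (Fin p) (Fin m) ℂ) (ω : ℝ) : ℂ :=
  ∑ a, ∑ j, (starRingEnd ℂ) (G (I * ω) a j) * K (I * ω) a j

section AxisInner

variable {p m : ℕ} {G K : ℂ → Matrix (Fin p) (Fin m) ℂ}

theorem integrable_axisInner (hG : ∀ a j, HalfPlaneDecay 1 fun s => G s a j)
    (hK : ∀ a j, HalfPlaneDecay 1 fun s => K s a j) : Integrable (axisInner G K) :=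
  integrable_finsetSum _ fun a _ => integrable_finsetSum _ fun j _ =>
    (hG a j).integrable_conj_mul (hK a j)

theorem conj_axisInner_self (G : ℂ → Matrix (Fin p) (Fin m) ℂ) (ω : ℝ) :
    (starRingEnd ℂ) (axisInner G G ω) = axisInner G G ω := by
  simp [axisInner, mul_comm]

/-- The two cross terms are conjugate, so under the real part they merge into one that is
holomorphic in the parameters of `K`. -/
theorem frobNorm_sub_sq (G K : ℂ → Matrix (Fin p) (Fin m) ℂ) (ω : ℝ) :
    frobNorm (G (I * ω) - K (I * ω)) ^ 2 =
      (axisInner G G ω - 2 * axisInner G K ω + axisInner K K ω).re := by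
  rw [frobNorm, Real.sq_sqrt (by positivity)]
  simp only [axisInner, Finset.mul_sum, ← Finset.sum_sub_distrib, ← Finset.sum_add_distrib, re_sum]
  refine Finset.sum_congr rfl fun a _ => Finset.sum_congr rfl fun j _ => ?_
  rw [← normSq_eq_norm_sq, normSq_apply]
  simp
  ring

theorem hasFiniteH2Norm_sub (hG : ∀ a j, HalfPlaneDecay 1 fun s => G s a j)
    (hK : ∀ a j, HalfPlaneDecay 1 fun s => K s a j) :
    HasFiniteH2Norm fun s => G s - K s := by
  have h := ((integrable_axisInner hG hG).sub ((integrable_axisInner hG hK).const_mul 2)).add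
    (integrable_axisInner hK hK)
  exact h.re.congr (ae_of_all _ fun ω => (frobNorm_sub_sq G K ω).symm)

theorem h2Norm_sub_sq (hG : ∀ a j, HalfPlaneDecay 1 fun s => G s a j)
    (hK : ∀ a j, HalfPlaneDecay 1 fun s => K s a j) :
    h2Norm (fun s => G s - K s) ^ 2 =
      ((2 * Real.pi : ℂ)⁻¹ * ((∫ ω, axisInner G G ω) - 2 * (∫ ω, axisInner G K ω) +
        ∫ ω, axisInner K K ω)).re := by
  have hGG := integrable_axisInner hG hG
  have hGK := (integrable_axisInner hG hK).const_mul 2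
  have hKK := integrable_axisInner hK hK
  rw [h2Norm, Real.sq_sqrt]
  · have h1 : (∫ ω, axisInner G G ω) - 2 * (∫ ω, axisInner G K ω) + ∫ ω, axisInner K K ω =
        ∫ ω, (axisInner G G ω - 2 * axisInner G K ω + axisInner K K ω) := by
      have hsub : Integrable fun ω => axisInner G G ω - 2 * axisInner G K ω := hGG.sub hGK
      rw [integral_add hsub hKK, integral_sub hGG hGK, integral_const_mul]
    have h2 : (2 * Real.pi : ℂ)⁻¹ = ((1 / (2 * Real.pi) : ℝ) : ℂ) := by push_cast; simp
    rw [h1, h2, re_ofReal_mul]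
    congr 1
    have h3 := reCLM.integral_comp_comm ((hGG.sub hGK).add hKK)
    simp only [reCLM_apply] at h3
    refine Eq.trans ?_ h3
    congr 1; funext ω; exact frobNorm_sub_sq G K ω
  · exact mul_nonneg (by positivity) (integral_nonneg fun ω => by positivity)

end AxisInner

/-! ### Pole-residue forms, conjugation and the pairing. -/

namespace PRParams

variable {r m p : ℕ} {θ η : PRParams r m p}

theorem reduced_apply (θ : PRParams r m p) (s : ℂ) (a : Fin p) (j : Fin m) :
    θ.reduced s a j = ∑ i, (s - θ.pole i)⁻¹ * (θ.ldir i a * θ.rdir i j) := by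
  simp [reduced, Matrix.sum_apply, Matrix.vecMulVec_apply]

@[simp] theorem star_pole (θ : PRParams r m p) (i : Fin r) :
    (star θ).pole i = (starRingEnd ℂ) (θ.pole i) := rfl

@[simp] theorem star_ldir (θ : PRParams r m p) (i : Fin r) (a : Fin p) :
    (star θ).ldir i a = (starRingEnd ℂ) (θ.ldir i a) := rfl

@[simp] theorem star_rdir (θ : PRParams r m p) (i : Fin r) (j : Fin m) :
    (star θ).rdir i j = (starRingEnd ℂ) (θ.rdir i j) := rfl

theorem IsStable.star (hθ : θ.IsStable) : (star θ).IsStable := fun i => by simpa using hθ i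

theorem isOpen_isStable : IsOpen {θ : PRParams r m p | θ.IsStable} := by
  simp only [IsStable, pole, Set.ofPred_forall]
  exact isOpen_iInter_of_finite fun i => isOpen_lt (by fun_prop) continuous_const

theorem halfPlaneDecay_reduced (hθ : θ.IsStable) (a : Fin p) (j : Fin m) :
    HalfPlaneDecay 1 fun s => θ.reduced s a j := by
  simp only [reduced_apply, mul_comm _ (_ * _)]
  exact HalfPlaneDecay.sum _ fun i _ => (HalfPlaneDecay.inv_sub (hθ i)).const_mul _

theorem conjReflect_reduced (θ : PRParams r m p) : conjReflect θ.reduced = (star θ).reduced := by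
  funext s
  ext a j
  simp [conjReflect, reduced_apply]

/-- The closed right half-plane avoids all poles and their conjugates, so reality applies. The
parameters themselves need not be invariant under conjugation. -/
theorem reduced_star_of_isReal (hθ : θ.IsStable) (hr : θ.IsReal) {s : ℂ} (hs : 0 ≤ s.re) :
    (star θ).reduced s = θ.reduced s := by
  have h := hr s (fun i h => by have := hθ i; rw [← h] at this; linarith)
    (fun i h => by have := hθ i; rw [← h] at this; simp at this; linarith)
  rw [← conjReflect_reduced]
  ext a j
  have h' : θ.reduced ((starRingEnd ℂ) s) = (θ.reduced s).map star := h
  simp [conjReflect, h']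

theorem isReal_of_star_eq (h : star θ = θ) : θ.IsReal := by
  intro s _ _
  have := congrFun (conjReflect_reduced θ) (star s)
  rw [h] at this
  rw [← this]
  ext a j
  simp [conjReflect]

/-- `∑ i, c_iᵀ G(-λ_i) b_i`. -/
def pairing (G : ℂ → Matrix (Fin p) (Fin m) ℂ) (θ : PRParams r m p) : ℂ :=
  ∑ i, ∑ a, ∑ j, G (-θ.pole i) a j * (θ.ldir i a * θ.rdir i j)

theorem pairing_star (G : ℂ → Matrix (Fin p) (Fin m) ℂ) (θ : PRParams r m p) :
    pairing G (star θ) = (starRingEnd ℂ) (pairing (conjReflect G) θ) := by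
  simp [pairing, conjReflect]

/-- Both sides are double sums over pairs of poles with the symmetric kernel `-1 / (λ_i + μ_k)`. -/
theorem pairing_reduced_comm (θ η : PRParams r m p) :
    pairing η.reduced θ = pairing θ.reduced η := by
  have key : ∀ θ η : PRParams r m p, pairing η.reduced θ = ∑ i, ∑ k, ∑ a, ∑ j,
      (-θ.pole i - η.pole k)⁻¹ * (η.ldir k a * η.rdir k j * (θ.ldir i a * θ.rdir i j)) := by
    intro θ η
    simp only [pairing, reduced_apply, Finset.sum_mul]
    refine Finset.sum_congr rfl fun i _ => ?_
    rw [Finset.sum_comm]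
    conv_lhs => enter [2, j]; rw [Finset.sum_comm]
    rw [Finset.sum_comm]
    conv_lhs => enter [2, k]; rw [Finset.sum_comm]
    refine Finset.sum_congr rfl fun k _ => Finset.sum_congr rfl fun a _ =>
      Finset.sum_congr rfl fun j _ => by ring
  rw [key, key, Finset.sum_comm]
  refine Finset.sum_congr rfl fun k _ => Finset.sum_congr rfl fun i _ =>
    Finset.sum_congr rfl fun a _ => Finset.sum_congr rfl fun j _ => ?_
  rw [show -θ.pole i - η.pole k = -η.pole k - θ.pole i by ring]
  ring

theorem integral_axisInner_reduced {G : ℂ → Matrix (Fin p) (Fin m) ℂ}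
    (hG : ∀ a j, HalfPlaneDecay 1 fun s => G s a j) (hθ : θ.IsStable) :
    ∫ ω, axisInner G θ.reduced ω = 2 * Real.pi * pairing (conjReflect G) θ := by
  have hint : ∀ i a j, Integrable fun ω : ℝ => (starRingEnd ℂ) (G (I * ω) a j) *
      (I * ω - θ.pole i)⁻¹ * (θ.ldir i a * θ.rdir i j) := fun i a j =>
    ((hG a j).integrable_conj_mul (HalfPlaneDecay.inv_sub (hθ i))).mul_const _
  simp only [axisInner, reduced_apply, Finset.mul_sum, ← mul_assoc]
  simp only [mul_assoc _ (θ.ldir _ _)]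
  rw [integral_finsetSum _ fun a _ => integrable_finsetSum _ fun j _ =>
    integrable_finsetSum _ fun i _ => hint i a j]
  simp only [pairing, Finset.mul_sum]
  rw [Finset.sum_comm]
  refine Finset.sum_congr rfl fun a _ => ?_
  rw [integral_finsetSum _ fun j _ => integrable_finsetSum _ fun i _ => hint i a j,
    Finset.sum_comm]
  refine Finset.sum_congr rfl fun j _ => ?_
  rw [integral_finsetSum _ fun i _ => hint i a j]
  refine Finset.sum_congr rfl fun i _ => ?_
  rw [integral_mul_const, (hG a j).integral_conj_mul_inv_sub (hθ i)]
  simp [conjReflect, mul_assoc]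

end PRParams

theorem LTISystem.conjReflect_transfer {n m p : ℕ} (S : LTISystem n m p) :
    conjReflect S.transfer = S.transfer := by
  funext s
  ext a j
  exact S.conj_transfer s a j

/-! ### The error as a polarized holomorphic expression. -/

open PRParams

section Error

variable {n m p r : ℕ} (S : LTISystem n m p)

/-- `N - 2 ∑ c_iᵀ H(-λ_i) b_i + ∑ c_iᵀ K(-λ_i) b_i`, with `N` the squared norm of `H` and `K` the
reduced transfer function of a second set of parameters. -/
def polarizedError (θ η : PRParams r m p) : ℂ :=
  (2 * Real.pi : ℂ)⁻¹ * (∫ ω, axisInner S.transfer S.transfer ω) - 2 * pairing S.transfer θ +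
    pairing η.reduced θ

variable {S} (hS : S.IsStable) (hS0 : S.VanishesAtInfinity) {θ : PRParams r m p}
include hS hS0

theorem h2Error_eq (hθ : θ.IsStable) : h2Error S θ = (polarizedError S θ (star θ)).re := by
  have hH := S.halfPlaneDecay_transfer hS hS0
  have hR := fun a j => halfPlaneDecay_reduced hθ a j
  have hpi : (2 * Real.pi : ℂ) ≠ 0 := by
    simp [Real.pi_ne_zero]
  rw [h2Error, h2Norm_sub_sq hH hR, integral_axisInner_reduced hH hθ,
    integral_axisInner_reduced hR hθ, S.conjReflect_transfer, conjReflect_reduced, polarizedError]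
  congr 1
  field_simp

/-- Both pairings are axis integrals of `H` against reduced functions that coincide on the axis. No
matching of the individual poles is required. -/
theorem pairing_transfer_star (hθ : θ.IsStable) (hr : θ.IsReal) :
    pairing S.transfer (star θ) = pairing S.transfer θ := by
  have hH := S.halfPlaneDecay_transfer hS hS0
  have h1 := integral_axisInner_reduced hH hθ
  have h2 := integral_axisInner_reduced hH hθ.star
  have hpi : (2 * Real.pi : ℂ) ≠ 0 := by
    simp [Real.pi_ne_zero]
  rw [S.conjReflect_transfer] at h1 h2
  refine mul_left_cancel₀ hpi ?_
  rw [← h1, ← h2]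
  congr 1; funext ω
  simp only [axisInner, reduced_star_of_isReal hθ hr (s := I * ω) (by simp)]

theorem polarizedError_self_of_isReal (hθ : θ.IsStable) (hr : θ.IsReal) :
    polarizedError S θ θ = (h2Error S θ : ℂ) := by
  have hpair : pairing θ.reduced θ = pairing (star θ).reduced θ := by
    simp only [pairing]
    refine Finset.sum_congr rfl fun i _ => ?_
    rw [reduced_star_of_isReal hθ hr (by simpa using (hθ i).le)]
  rw [h2Error_eq hS hS0 hθ]
  have h1 : polarizedError S θ θ = polarizedError S θ (star θ) := by
    rw [polarizedError, polarizedError, hpair]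
  rw [h1]
  symm
  -- It remains to see that the value is real; each of its three terms is fixed by conjugation.
  rw [← conj_eq_iff_re]
  have hN : (starRingEnd ℂ) (∫ ω, axisInner S.transfer S.transfer ω) =
      ∫ ω, axisInner S.transfer S.transfer ω := by
    rw [← integral_conj]
    simp only [conj_axisInner_self]
  have hL : (starRingEnd ℂ) (pairing S.transfer θ) = pairing S.transfer θ := by
    have := pairing_star S.transfer θ
    rwa [S.conjReflect_transfer, pairing_transfer_star hS hS0 hθ hr, eq_comm] at this
  have hP : (starRingEnd ℂ) (pairing (star θ).reduced θ) = pairing (star θ).reduced θ := by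
    have := pairing_star θ.reduced θ
    rw [conjReflect_reduced] at this
    rw [← this, pairing_reduced_comm]
  simp [polarizedError, hN, hL, hP, Complex.conj_ofNat]

end Error

/-! ### Derivatives of the pairing. -/

namespace PRParams

variable {r m p : ℕ} {θ η : PRParams r m p} {G K : ℂ → Matrix (Fin p) (Fin m) ℂ}

/-- The derivative of `pairing G` at `θ` in the direction `δ`. -/
def pairingDeriv (G : ℂ → Matrix (Fin p) (Fin m) ℂ) (θ δ : PRParams r m p) : ℂ :=
  ∑ i, ∑ a, ∑ j, (-(matDeriv G (-θ.pole i) a j * δ.pole i) * (θ.ldir i a * θ.rdir i j) +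
    G (-θ.pole i) a j * (δ.ldir i a * θ.rdir i j + θ.ldir i a * δ.rdir i j))

theorem pairingDeriv_star (G : ℂ → Matrix (Fin p) (Fin m) ℂ) (θ δ : PRParams r m p) :
    pairingDeriv G (star θ) (star δ) = (starRingEnd ℂ) (pairingDeriv (conjReflect G) θ δ) := by
  have h : ∀ s a j, matDeriv (conjReflect G) s a j =
      (starRingEnd ℂ) (matDeriv G ((starRingEnd ℂ) s) a j) := fun s a j =>
    congrFun (deriv_conj_conj (f := fun z => G z a j)) s
  simp [pairingDeriv, h, conjReflect]

theorem pairingDeriv_congr (hθ : θ.IsStable) (h : ∀ s : ℂ, 0 < s.re → G s = K s)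
    (δ : PRParams r m p) : pairingDeriv G θ δ = pairingDeriv K θ δ := by
  have hs : ∀ i, 0 < (-θ.pole i).re := fun i => by simpa using hθ i
  have hd : ∀ i a j, matDeriv G (-θ.pole i) a j = matDeriv K (-θ.pole i) a j := by
    intro i a j
    refine EventuallyEq.deriv_eq ?_
    filter_upwards [(isOpen_lt continuous_const continuous_re).mem_nhds (hs i)] with z hz
    rw [h z hz]
  simp only [pairingDeriv, hd, h _ (hs _)]

theorem differentiableAt_pairing (hθ : θ.IsStable)
    (hG : ∀ s : ℂ, 0 < s.re → ∀ a j, DifferentiableAt ℂ (fun z => G z a j) s) :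
    DifferentiableAt ℂ (pairing G : PRParams r m p → ℂ) θ := by
  have h : ∀ i a j, DifferentiableAt ℂ (fun η : PRParams r m p => G (-η.1 i) a j) θ :=
    fun i a j => DifferentiableAt.comp (g := fun z => G z a j) θ
      (hG _ (by simpa [pole] using hθ i) a j) (by fun_prop)
  unfold pairing pole ldir rdir
  exact DifferentiableAt.fun_sum fun i _ => DifferentiableAt.fun_sum fun a _ =>
    DifferentiableAt.fun_sum fun j _ => (h i a j).mul (by fun_prop)

theorem fderiv_pairing (hθ : θ.IsStable)
    (hG : ∀ s : ℂ, 0 < s.re → ∀ a j, DifferentiableAt ℂ (fun z => G z a j) s)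
    (δ : PRParams r m p) :
    fderiv ℂ (pairing G : PRParams r m p → ℂ) θ δ = pairingDeriv G θ δ := by
  rw [← (differentiableAt_pairing hθ hG).lineDeriv_eq_fderiv]
  refine HasDerivAt.deriv ?_
  have hadd : ∀ (u v : ℂ), HasDerivAt (fun t : ℂ => u + t * v) v 0 := fun u v => by
    simpa using ((hasDerivAt_id (0 : ℂ)).mul_const v).const_add u
  have hsum : ∀ i a j, HasDerivAt (fun t : ℂ =>
      G (-(θ.pole i + t * δ.pole i)) a j *
        ((θ.ldir i a + t * δ.ldir i a) * (θ.rdir i j + t * δ.rdir i j)))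
      (-(matDeriv G (-θ.pole i) a j * δ.pole i) * (θ.ldir i a * θ.rdir i j) +
        G (-θ.pole i) a j * (δ.ldir i a * θ.rdir i j + θ.ldir i a * δ.rdir i j)) 0 := by
    intro i a j
    have h1 : HasDerivAt (fun z => G z a j) (matDeriv G (-θ.pole i) a j)
        (-(θ.pole i + 0 * δ.pole i)) := by
      rw [zero_mul, add_zero]
      exact (hG _ (by simpa using hθ i) a j).hasDerivAt
    have h2 := h1.comp (0 : ℂ) (hadd (θ.pole i) (δ.pole i)).neg
    have h3 := h2.mul ((hadd (θ.ldir i a) (δ.ldir i a)).mul (hadd (θ.rdir i j) (δ.rdir i j)))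
    refine h3.congr_deriv ?_
    simp
  exact HasDerivAt.fun_sum fun i _ => HasDerivAt.fun_sum fun a _ => HasDerivAt.fun_sum fun j _ =>
    hsum i a j

theorem differentiableAt_reduced (hθ : θ.IsStable) (s : ℂ) (hs : 0 < s.re) (a : Fin p)
    (j : Fin m) : DifferentiableAt ℂ (fun z => θ.reduced z a j) s :=
  (halfPlaneDecay_reduced hθ a j).differentiableAt s hs.le

theorem differentiableAt_pairing_reduced (hθ : θ.IsStable) (hη : η.IsStable) :
    DifferentiableAt ℂ
      (fun x : PRParams r m p × PRParams r m p => pairing x.2.reduced x.1) (θ, η) := by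
  have hne : ∀ i k, -θ.1 i - η.1 k ≠ 0 := fun i k h => by
    have h1 := hθ i
    have h2 := hη k
    have := congrArg re h
    simp [pole] at this h1 h2
    linarith
  have h : ∀ i k, DifferentiableAt ℂ
      (fun x : PRParams r m p × PRParams r m p => (-x.1.1 i - x.2.1 k)⁻¹) (θ, η) :=
    fun i k => DifferentiableAt.inv (by fun_prop) (hne i k)
  simp only [pairing, reduced_apply]
  unfold pole ldir rdir
  fun_prop

/-- The derivative in the second argument reduces to the first by the symmetry of the pairing. -/
theorem fderiv_pairing_reduced (hθ : θ.IsStable) (hη : η.IsStable) (δ ε : PRParams r m p) :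
    fderiv ℂ (fun x : PRParams r m p × PRParams r m p => pairing x.2.reduced x.1) (θ, η) (δ, ε) =
      pairingDeriv η.reduced θ δ + pairingDeriv θ.reduced η ε := by
  have hd := (differentiableAt_pairing_reduced hθ hη).hasFDerivAt
  have h1 := hd.comp (f := fun x => (x, η)) θ (hasFDerivAt_prodMk_left θ η)
  have h2 := hd.comp (f := fun x => (θ, x)) η (hasFDerivAt_prodMk_right θ η)
  have h2' : ((fun x : PRParams r m p × PRParams r m p => pairing x.2.reduced x.1) ∘
      fun x => (θ, x)) = pairing θ.reduced := by
    funext x; exact pairing_reduced_comm θ x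
  rw [h2'] at h2
  have e1 := fderiv_pairing hθ (fun s hs a j => differentiableAt_reduced hη s hs a j) δ
  have e2 := fderiv_pairing hη (fun s hs a j => differentiableAt_reduced hθ s hs a j) ε
  have f1 := congrArg (fun L : PRParams r m p →L[ℂ] ℂ => L δ) h1.fderiv
  have f2 := congrArg (fun L : PRParams r m p →L[ℂ] ℂ => L ε) h2.fderiv
  rw [← e1, ← e2]
  refine Eq.trans ?_ (congrArg₂ (· + ·) f1 f2).symm
  simp [← map_add]

end PRParams

/-! ### The gradient formulas. -/

open PRParams

section Error

variable {n m p r : ℕ} {S : LTISystem n m p} {θ : PRParams r m p}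

theorem differentiableAt_transfer_of_pos (hS : S.IsStable) (s : ℂ) (hs : 0 < s.re) (a : Fin p)
    (j : Fin m) : DifferentiableAt ℂ (fun z => S.transfer z a j) s :=
  S.differentiableAt_transfer (fun h => absurd (hS s h) (not_lt.2 hs.le)) a j

theorem hasFDerivAt_polarizedError (hS : S.IsStable) {η : PRParams r m p} (hθ : θ.IsStable)
    (hη : η.IsStable) :
    ∃ L : PRParams r m p × PRParams r m p →L[ℂ] ℂ,
      HasFDerivAt (fun x : PRParams r m p × PRParams r m p => polarizedError S x.1 x.2) L (θ, η) ∧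
      ∀ δ ε, L (δ, ε) = -2 * pairingDeriv S.transfer θ δ + pairingDeriv η.reduced θ δ +
        pairingDeriv θ.reduced η ε := by
  have hH := differentiableAt_transfer_of_pos hS
  have h1 := (differentiableAt_pairing hθ hH).hasFDerivAt.comp
    (θ, η) (f := Prod.fst) hasFDerivAt_fst
  have h2 := (differentiableAt_pairing_reduced hθ hη).hasFDerivAt
  refine ⟨_, ((h1.const_mul 2).const_sub _).add h2, fun δ ε => ?_⟩
  simp only [add_apply, fderiv_pairing_reduced hθ hη]
  simp [fderiv_pairing hθ hH]
  ring

theorem two_mul_pairingDeriv_sub (S : LTISystem n m p) (θ δ : PRParams r m p) :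
    2 * (pairingDeriv θ.reduced θ δ - pairingDeriv S.transfer θ δ) =
      ∑ i, poleGrad S θ i * δ.1 i + ∑ l, ∑ a, dirGrad S θ l a * δ.2 l a := by
  rw [← Finset.sum_add_distrib]
  simp only [pairingDeriv, ← Finset.sum_sub_distrib, Finset.mul_sum]
  refine Finset.sum_congr rfl fun i _ => ?_
  simp only [poleGrad, dirGrad, Fintype.sum_sum_type, Sum.elim_inl, Sum.elim_inr, Pi.smul_apply,
    Pi.sub_apply, smul_eq_mul, Matrix.vecMul, Matrix.mulVec, dotProduct, Finset.mul_sum,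
    Finset.sum_mul, ← Finset.sum_sub_distrib, Matrix.sub_apply]
  rw [Finset.sum_comm (s := (Finset.univ : Finset (Fin m)))]
  simp only [← Finset.sum_add_distrib]
  refine Finset.sum_congr rfl fun a _ => Finset.sum_congr rfl fun j _ => ?_
  simp only [pole, ldir, rdir]
  ring

theorem hasFDerivAt_polarizedError_diag (hS : S.IsStable) (hθ : θ.IsStable) :
    ∃ L : PRParams r m p →L[ℂ] ℂ, HasFDerivAt (fun x => polarizedError S x x) L θ ∧
      ∀ δ, L δ = ∑ i, poleGrad S θ i * δ.1 i + ∑ l, ∑ a, dirGrad S θ l a * δ.2 l a := by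
  obtain ⟨L, hL, hLa⟩ := hasFDerivAt_polarizedError hS hθ hθ
  refine ⟨_, hL.comp θ (f := fun x => (x, x)) ((hasFDerivAt_id θ).prodMk (hasFDerivAt_id θ)),
    fun δ => ?_⟩
  rw [← two_mul_pairingDeriv_sub]
  refine (hLa δ δ).trans ?_
  ring

/-- Chain rule along the real-linear map `x ↦ (x, star x)`. The term from `star δ` is the conjugate
of the one from `δ`, so the real parts add up. Reality at the base point then replaces `(star
θ).reduced` by `θ.reduced`. -/
theorem hasFDerivAt_h2Error (hS : S.IsStable) (hS0 : S.VanishesAtInfinity) (hθ : θ.IsStable)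
    (hr : θ.IsReal) :
    ∃ L : PRParams r m p →L[ℝ] ℝ, HasFDerivAt (h2Error S : PRParams r m p → ℝ) L θ ∧
      ∀ δ, L δ = (∑ i, poleGrad S θ i * δ.1 i + ∑ l, ∑ a, dirGrad S θ l a * δ.2 l a).re := by
  obtain ⟨L, hL, hLa⟩ := hasFDerivAt_polarizedError hS hθ hθ.star
  have hst : HasFDerivAt (fun x : PRParams r m p => (x, star x))
      ((ContinuousLinearMap.id ℝ _).prod (starL' ℝ : PRParams r m p ≃L[ℝ] _).toContinuousLinearMap)
      θ := (hasFDerivAt_id θ).prodMk (starL' ℝ : PRParams r m p ≃L[ℝ] _).hasFDerivAt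
  have h := reCLM.hasFDerivAt.comp θ ((hL.restrictScalars ℝ).comp θ hst)
  refine ⟨_, h.congr_of_eventuallyEq ?_, fun δ => ?_⟩
  · filter_upwards [isOpen_isStable.mem_nhds hθ] with x hx using h2Error_eq hS hS0 hx
  · rw [← two_mul_pairingDeriv_sub]
    have e : ∀ s : ℂ, 0 < s.re → (star θ).reduced s = θ.reduced s :=
      fun s hs => reduced_star_of_isReal hθ hr hs.le
    refine (congrArg re (hLa δ (star δ))).trans ?_
    rw [pairingDeriv_star, conjReflect_reduced, pairingDeriv_congr hθ e]
    simp
    ring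

/-! ### Uniqueness of the holomorphic extension. -/

/-- A holomorphic function on the set of stable parameters is determined by its values at the
parameters fixed by complex conjugation. -/
theorem eq_of_eqOn_star_eq {F F' : PRParams r m p → ℂ}
    (hF : DifferentiableOn ℂ F {θ | θ.IsStable}) (hF' : DifferentiableOn ℂ F' {θ | θ.IsStable})
    (h : ∀ θ : PRParams r m p, θ.IsStable → star θ = θ → F θ = F' θ) (hθ : θ.IsStable) :
    F θ = F' θ := by
  -- Split `θ = x + I • y` with `x`, `y` fixed by `star`. On the complex line `x + w • y`, real `w`
  -- gives parameters fixed by `star` and `w = I` gives `θ`, so the identity theorem in `w`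
  -- suffices.
  obtain ⟨x, hx⟩ : ∃ x : PRParams r m p, x = (2⁻¹ : ℂ) • (θ + star θ) := ⟨_, rfl⟩
  obtain ⟨y, hy⟩ : ∃ y : PRParams r m p, y = (-I / 2) • (θ - star θ) := ⟨_, rfl⟩
  have hsx : star x = x := by
    rw [hx, star_smul, star_add, star_star, add_comm]; simp
  have hsy : star y = y := by
    rw [hy, star_smul, star_sub, star_star, ← neg_sub θ, smul_neg, ← neg_smul]
    congr 1
    simp [neg_div]
  have hxy : x + I • y = θ := by
    rw [hx, hy, smul_smul, show I * (-I / 2) = (2⁻¹ : ℂ) by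
      rw [mul_div_assoc', mul_neg, I_mul_I]; norm_num]
    rw [← smul_add, add_add_sub_cancel, ← two_smul ℂ θ, smul_smul]
    norm_num
  set U : Set ℂ := {w | (x + w • y).IsStable} with hU
  have hUo : IsOpen U := isOpen_isStable.preimage (f := fun w : ℂ => x + w • y) (by fun_prop)
  -- Stability is a finite set of real half-plane conditions on `w`, so the slice is convex and
  -- hence connected.
  have hUc : Convex ℝ U := by
    intro u hu v hv a b ha hb hab i
    have h1 : (x.1 i + u * y.1 i).re < 0 := hu i
    have h2 : (x.1 i + v * y.1 i).re < 0 := hv i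
    have h3 : ((x + (a • u + b • v) • y).pole i).re =
        a * (x.1 i + u * y.1 i).re + b * (x.1 i + v * y.1 i).re := by
      have : ((x + (a • u + b • v) • y).pole i).re = (x.1 i + (a • u + b • v) * y.1 i).re := rfl
      rw [this, show b = 1 - a by linarith]
      simp
      ring
    rw [h3]
    rcases ha.eq_or_lt with rfl | ha'
    · have : b = 1 := by linarith
      subst this; linarith
    · nlinarith [mul_neg_of_pos_of_neg ha' h1, mul_nonpos_of_nonneg_of_nonpos hb h2.le]
  have hI : I ∈ U := by
    rw [hU, Set.mem_ofPred_eq, hxy]; exact hθ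
  -- Averaging with the conjugate keeps the real parts of the poles, so `x` is stable.
  have h0 : (0 : ℂ) ∈ U := by
    intro i
    have : ((x + (0 : ℂ) • y).pole i).re = (θ.pole i).re := by
      rw [zero_smul, add_zero]
      have : x.pole i = 2⁻¹ * (θ.pole i + (starRingEnd ℂ) (θ.pole i)) := by rw [hx]; rfl
      rw [this, add_conj]
      simp
    rw [this]; exact hθ i
  have hana : ∀ {E : PRParams r m p → ℂ}, DifferentiableOn ℂ E {θ | θ.IsStable} →
      AnalyticOnNhd ℂ (fun w : ℂ => E (x + w • y)) U := by
    intro E hE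
    refine DifferentiableOn.analyticOnNhd ?_ hUo
    exact hE.comp (f := fun w : ℂ => x + w • y) (by fun_prop) fun w hw => hw
  have hfreq : ∃ᶠ w in 𝓝[≠] (0 : ℂ), F (x + w • y) = F' (x + w • y) := by
    have hreal : ∀ᶠ t : ℝ in 𝓝[≠] (0 : ℝ), F (x + (t : ℂ) • y) = F' (x + (t : ℂ) • y) := by
      have hc : Tendsto (fun t : ℝ => (t : ℂ)) (𝓝[≠] 0) (𝓝 ((0 : ℝ) : ℂ)) :=
        continuous_ofReal.continuousAt.tendsto.mono_left nhdsWithin_le_nhds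
      rw [ofReal_zero] at hc
      filter_upwards [hc.eventually (hUo.mem_nhds h0)] with t ht
      refine h _ ht ?_
      rw [star_add, star_smul, hsx, hsy]
      simp
    have hc : Tendsto (fun t : ℝ => (t : ℂ)) (𝓝[≠] 0) (𝓝[≠] 0) := by
      refine tendsto_nhdsWithin_iff.2 ⟨?_, ?_⟩
      · have := continuous_ofReal.tendsto (0 : ℝ)
        rw [ofReal_zero] at this
        exact this.mono_left nhdsWithin_le_nhds
      · filter_upwards [self_mem_nhdsWithin] with t ht
        simpa using ht
    exact hc.frequently hreal.frequently
  have := (hana hF).eqOn_of_preconnected_of_frequently_eq (hana hF') hUc.isPreconnected h0 hfreq hI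
  simpa only [hxy] using this

theorem IsHolomorphicError.eqOn {K J : PRParams r m p → ℂ} (hK : IsHolomorphicError S K)
    (hJ : IsHolomorphicError S J) : Set.EqOn K J {θ | θ.IsStable} := fun _ hθ =>
  eq_of_eqOn_star_eq hK.1 hJ.1 (fun θ hθ hs => (hK.2 θ hθ (isReal_of_star_eq hs)).trans
    (hJ.2 θ hθ (isReal_of_star_eq hs)).symm) hθ

theorem isHolomorphicError_polarizedError (hS : S.IsStable) (hS0 : S.VanishesAtInfinity) :
    IsHolomorphicError S fun θ : PRParams r m p => polarizedError S θ θ := by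
  refine ⟨fun θ hθ => ?_, fun θ hθ hr => polarizedError_self_of_isReal hS hS0 hθ hr⟩
  obtain ⟨L, hL, -⟩ := hasFDerivAt_polarizedError_diag hS hθ
  exact hL.differentiableAt.differentiableWithinAt

end Error

/-! ### Coordinatewise derivatives and conclusion. -/

theorem HasFDerivAt.hasDerivAt_update_pole {r m p : ℕ} {F : PRParams r m p → ℂ}
    {L : PRParams r m p →L[ℂ] ℂ} {θ : PRParams r m p} (hF : HasFDerivAt F L θ) (i : Fin r) :
    HasDerivAt (fun z : ℂ => F (Function.update θ.1 i z, θ.2)) (L (Pi.single i 1, 0)) (θ.1 i) := by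
  have hc : HasDerivAt (fun z : ℂ => ((Function.update θ.1 i z, θ.2) : PRParams r m p))
      (Pi.single i 1, 0) (θ.1 i) :=
    (hasDerivAt_update θ.1 i (θ.1 i)).prodMk (hasDerivAt_const _ _)
  have he : θ = ((Function.update θ.1 i (θ.1 i), θ.2) : PRParams r m p) := by
    rw [Function.update_eq_self]
  exact HasFDerivAt.comp_hasDerivAt_of_eq (θ.1 i) hF hc he

theorem HasFDerivAt.hasDerivAt_update_dir {r m p : ℕ} {F : PRParams r m p → ℂ}
    {L : PRParams r m p →L[ℂ] ℂ} {θ : PRParams r m p} (hF : HasFDerivAt F L θ) (l : Fin r)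
    (a : Fin m ⊕ Fin p) :
    HasDerivAt (fun z : ℂ => F (θ.1, Function.update θ.2 l (Function.update (θ.2 l) a z)))
      (L (0, Pi.single l (Pi.single a 1))) (θ.2 l a) := by
  have hc : HasDerivAt (fun z : ℂ =>
      ((θ.1, Function.update θ.2 l (Function.update (θ.2 l) a z)) : PRParams r m p))
      (0, Pi.single l (Pi.single a 1)) (θ.2 l a) := by
    refine (hasDerivAt_const _ _).prodMk (hasDerivAt_pi.2 fun k => ?_)
    rcases eq_or_ne k l with rfl | hk
    · simpa using hasDerivAt_update (θ.2 k) a (θ.2 k a)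
    · simpa [hk] using hasDerivAt_const (θ.2 l a) (θ.2 k)
  have he : θ = ((θ.1, Function.update θ.2 l (Function.update (θ.2 l) a (θ.2 l a))) :
      PRParams r m p) := by
    rw [Function.update_eq_self, Function.update_eq_self]
  exact HasFDerivAt.comp_hasDerivAt_of_eq (θ.2 l a) hF hc he

theorem mainTheorem6 (n m p r : ℕ) (S : LTISystem n m p)
    (hS : S.IsStable) (hS0 : S.VanishesAtInfinity) :
    -- the transfer functions are holomorphic in the open right half-plane
    (∀ (s : ℂ), 0 < s.re → ∀ (a : Fin p) (j : Fin m),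
      DifferentiableAt ℂ (fun z => S.transfer z a j) s ∧
      ∀ θ : PRParams r m p, θ.IsStable → DifferentiableAt ℂ (fun z => θ.reduced z a j) s) ∧
    -- the error is finite
    (∀ θ : PRParams r m p, θ.IsStable →
      HasFiniteH2Norm (fun s => S.transfer s - θ.reduced s)) ∧
    -- total derivative of the error itself in all (real and imaginary) parameter directions
    (∀ θ : PRParams r m p, θ.IsStable → θ.IsReal →
      DifferentiableAt ℝ (h2Error S : PRParams r m p → ℝ) θ ∧
      ∀ δ : PRParams r m p,
        fderiv ℝ (h2Error S : PRParams r m p → ℝ) θ δ =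
          (∑ i, poleGrad S θ i * δ.1 i + ∑ l, ∑ a, dirGrad S θ l a * δ.2 l a).re) ∧
    -- complex partial derivatives, the error being expressed holomorphically in the parameters
    (∃ J : PRParams r m p → ℂ, IsHolomorphicError S J ∧
      (∀ K : PRParams r m p → ℂ, IsHolomorphicError S K → Set.EqOn K J {θ | θ.IsStable}) ∧
      ∀ θ : PRParams r m p, θ.IsStable →
        (∀ i : Fin r,
          HasDerivAt (fun z : ℂ => J (Function.update θ.1 i z, θ.2))
            (poleGrad S θ i) (θ.1 i)) ∧
        (∀ (l : Fin r) (a : Fin m ⊕ Fin p),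
          HasDerivAt (fun z : ℂ => J (θ.1, Function.update θ.2 l (Function.update (θ.2 l) a z)))
            (dirGrad S θ l a) (θ.2 l a))) := by
  refine ⟨fun s hs a j => ⟨differentiableAt_transfer_of_pos hS s hs a j,
    fun θ hθ => differentiableAt_reduced hθ s hs a j⟩, fun θ hθ =>
    hasFiniteH2Norm_sub (S.halfPlaneDecay_transfer hS hS0) (halfPlaneDecay_reduced hθ),
    fun θ hθ hr => ?_, fun θ => polarizedError S θ θ, ?_, ?_, fun θ hθ => ?_⟩
  · obtain ⟨L, hL, hLa⟩ := hasFDerivAt_h2Error hS hS0 hθ hr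
    exact ⟨hL.differentiableAt, fun δ => by rw [hL.fderiv, hLa]⟩
  · exact isHolomorphicError_polarizedError hS hS0
  · exact fun K hK => hK.eqOn (isHolomorphicError_polarizedError hS hS0)
  · obtain ⟨L, hL, hLa⟩ := hasFDerivAt_polarizedError_diag hS hθ
    refine ⟨fun i => (hL.hasDerivAt_update_pole i).congr_deriv ?_,
      fun l a => (hL.hasDerivAt_update_dir l a).congr_deriv ?_⟩
    · rw [hLa]
      simp [Pi.single_apply]
    · have h0 : ∑ i, poleGrad S θ i * (0 : Fin r → ℂ) i = 0 := by simp
      refine (hLa _).trans ?_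
      dsimp only
      rw [h0, zero_add, Finset.sum_eq_single l (fun k _ hk => by simp [Pi.single_eq_of_ne hk])
        (by simp), Finset.sum_eq_single a (fun b _ hb => by simp [Pi.single_eq_of_ne hb]) (by simp)]
      simp

end
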